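/- Let $q$ be a prime power, let $m\ge 1$ and $n\le m$, and for $\mathbf x\in \mathrm{GF}(q^m)^n$ let $\mathrm{rk}(\mathbf x)$ be the rank over $\mathrm{GF}(q)$ of the $m\times n$ matrix obtained by expanding the coordinates of $\mathbf x$ in a basis of $\mathrm{GF}(q^m)$ over $\mathrm{GF}(q)$; the rank distance of $\mathbf x,\mathbf y$ is $\mathrm{rk}(\mathbf x-\mathbf y)$. Let $C\subseteq \mathrm{GF}(q^m)^n$ be a (linear or nonlinear) maximum rank distance (MRD) code, that is, a code with at least two codewords whose minimum rank distance $d_R$ over pairs of distinct codewords satisfies $d_R=n-\log_{q^m}|C|+1$. Write $|C|=q^{mk}$ and $r=n-k$ (so $d_R=r+1$), let $t=\lfloor (d_R-1)/2\rfloor$, and assume that the all-zero vector is a codeword of $C$. Call a vector decodable if it lies within rank distance $t$ of some codeword, and let $D_u$ be the number of decodable vectors of rank $u$. Let $V_t=\sum_{i=0}^{t}N_i$, where $N_i$ is the number of vectors of rank $i$ in $\mathrm{GF}(q^m)^n$, and let ${n\brack u}=\prod_{i=0}^{u-1}\frac{q^n-q^i}{q^u-q^i}$ be the Gaussian binomial.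 Then for every integer $u$ with $d_R-t\le u<d_R$, $$D_u<\frac{q^2}{q^2-1}{n\brack u}(q^m-1)^{u-r}V_t .$$ -/

import Mathlib

noncomputable section

namespace RankMetric

section Rank

variable (F : Type*) {L : Type*} [Field F] [Field L] [Algebra F L] [FiniteDimensional F L] {n : ℕ}

/-- The rank norm of `x ∈ L ^ n` over `F`: the rank of the matrix over `F` whose `j`-th column
holds the coordinates of `x j` in a basis of `L` over `F`. -/
def rk (x : Fin n → L) : ℕ :=
  ((Module.finBasis F L).toMatrix x).rank

/-- The rank norm is the dimension of the `F`-span of the coordinates; in particular it does not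
depend on the basis. -/
theorem rk_eq_finrank_span (x : Fin n → L) :
    rk F x = Module.finrank F (Submodule.span F (Set.range x)) := by
  have h : Set.range ((Module.finBasis F L).toMatrix x).col
      = (Module.finBasis F L).equivFun '' Set.range x := by
    rw [← Set.range_comp]
    rfl
  rw [rk, Matrix.rank_eq_finrank_span_cols, h]
  have h2 := Submodule.map_span ((Module.finBasis F L).equivFun.toLinearMap) (Set.range x)
  have h3 := LinearEquiv.finrank_map_eq (Module.finBasis F L).equivFun
    (Submodule.span F (Set.range x))
  rw [← h3]
  exact congrArg (fun S : Submodule F _ => Module.finrank F S) h2.symm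

/-- The rank distance. -/
def rankDist (x y : Fin n → L) : ℕ := rk F (x - y)

/-- The minimum rank distance over all pairs of distinct codewords
(only meaningful for codes with at least two codewords). -/
def minRankDist (C : Set (Fin n → L)) : ℕ :=
  sInf {d | ∃ x ∈ C, ∃ y ∈ C, x ≠ y ∧ d = rankDist F x y}

/-- Maximum rank distance codes (linear or not): block codes with at least two codewords that
attain the Singleton bound `d ≤ n - log_{q^m} |C| + 1`, where `q = |F|` and `m = [L : F]`. -/
def IsMRD (C : Set (Fin n → L)) : Prop :=
  C.Nontrivial ∧
    (minRankDist F C : ℝ) =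
      (n : ℝ) - Real.logb ((Nat.card F : ℝ) ^ Module.finrank F L) (C.ncard : ℝ) + 1

/-- `x` lies within rank distance `t` of some codeword. -/
def Decodable (C : Set (Fin n → L)) (t : ℕ) (x : Fin n → L) : Prop :=
  ∃ c ∈ C, rankDist F x c ≤ t

/-- `D_u`: the number of decodable vectors of rank `u`. -/
def numDecodable (C : Set (Fin n → L)) (t u : ℕ) : ℕ :=
  {x : Fin n → L | rk F x = u ∧ Decodable F C t x}.ncard

variable (L n)

/-- `N_u`: the number of vectors of rank `u` in `L ^ n`. -/
def numRank (u : ℕ) : ℕ := {x : Fin n → L | rk F x = u}.ncard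

/-- `V_t = ∑_{i=0}^{t} N_i`: the volume of a ball of rank radius `t` in `L ^ n`. -/
def ballVolume (t : ℕ) : ℕ := ∑ i ∈ Finset.range (t + 1), numRank F L n i

end Rank

/-- `A(m,u) = ∏_{i=0}^{u-1} (q^m - q^i)`, with `A(m,0) = 1`. -/
def A (q m u : ℕ) : ℝ := ∏ i ∈ Finset.range u, ((q : ℝ) ^ m - (q : ℝ) ^ i)

/-- The Gaussian binomial `A(n,u) / A(u,u)`. -/
def gaussianBinomial (q n u : ℕ) : ℝ := A q n u / A q u u

end RankMetric

end

namespace RankMetric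

/-! ### Counting linear maps and subspaces over a finite field. -/

section Counting

open Module

variable {F V L : Type*} [Field F] [Finite F]
  [AddCommGroup V] [Module F V] [FiniteDimensional F V]
  [AddCommGroup L] [Module F L] [FiniteDimensional F L]

/-! Read a vector as a linear map `V = F ^ n → L`; its rank is that of the map. A map `x` of rank
`u` has a kernel `K` of codimension `u`, and there are at most `gaussianBinomial` many such `K`. If
`x = c + e` with `c` a codeword and `e` of rank at most `t < u`, then `c ≠ 0` and `e = -c` on `K`.
For fixed `K`, `e` determines `x` (`ncard_decodable_ker_le`), so it suffices to count the errors
`e`.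

Sort them by kernel `N`, of codimension `v ≤ t`, and put `s = r - u`. The minimum distance leaves
room in `K` for a subspace `S` of dimension `s` meeting `N` trivially. Let `W ⊇ N` be a complement
of `S`. The restriction to `W` determines `c`, hence `e` on `S`, so at most `A(m, v - s)` errors
have kernel `N` (`ncard_errorSet_ker_le`), against `A(m, v)` for all maps. Since `2 v ≤ m`, the
ratio is at most `q² / (q² - 1) * (q ^ m - 1) ^ (-s)` (`A_sub_le`). Summing over `N` and `K` gives
the bound; it is strict because the zero map counts in `V_t` but is never such an error. -/

theorem A_eq_zero_of_lt {q m u : ℕ} (h : m < u) : A q m u = 0 :=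
  Finset.prod_eq_zero (Finset.mem_range.2 h) (sub_self _)

/-- The number of linearly independent `k`-tuples. -/
theorem card_linearIndependent_eq_A (k : ℕ) :
    (Nat.card {s : Fin k → V // LinearIndependent F s} : ℝ) = A (Nat.card F) (finrank F V) k := by
  have : Finite V := Module.finite_of_finite F
  have := Fintype.ofFinite F
  by_cases hk : k ≤ finrank F V
  · rw [card_linearIndependent hk, Nat.card_eq_fintype_card, A, Nat.cast_prod,
      ← Fin.prod_univ_eq_prod_range
        (fun i => (Fintype.card F : ℝ) ^ finrank F V - (Fintype.card F : ℝ) ^ i)]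
    refine Finset.prod_congr rfl fun i _ => ?_
    rw [Nat.cast_sub (Nat.pow_le_pow_right Fintype.card_pos (i.2.le.trans hk))]
    push_cast
    rfl
  · have : IsEmpty {s : Fin k → V // LinearIndependent F s} :=
      ⟨fun s => hk (by simpa using s.2.fintype_card_le_finrank)⟩
    rw [Nat.card_of_isEmpty, Nat.cast_zero, A_eq_zero_of_lt (not_le.1 hk)]

theorem card_injective_linearMap :
    ({e : V →ₗ[F] L | LinearMap.ker e = ⊥}.ncard : ℝ)
      = A (Nat.card F) (finrank F L) (finrank F V) := by
  rw [← card_linearIndependent_eq_A (F := F) (V := L), ← Nat.card_coe_set_eq]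
  congr 1
  let b := finBasis F V
  refine Nat.card_congr ((b.constr F).symm.toEquiv.subtypeEquiv fun e => ?_)
  have : ((b.constr F).symm.toEquiv e : Fin (finrank F V) → L) = e ∘ b := rfl
  rw [this]
  refine ⟨fun h => b.linearIndependent.map' e h, fun h => ?_⟩
  rw [Set.mem_ofPred_eq, LinearMap.ker_eq_bot']
  intro x hx
  rw [← b.sum_repr x] at hx ⊢
  rw [map_sum] at hx
  simp only [map_smul] at hx
  have := Fintype.linearIndependent_iff.1 h _ hx
  simp [this]

/-- The number of linear maps with a given kernel. -/
theorem card_ker_eq (N : Submodule F V) :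
    ({e : V →ₗ[F] L | LinearMap.ker e = N}.ncard : ℝ)
      = A (Nat.card F) (finrank F L) (finrank F (V ⧸ N)) := by
  rw [← card_injective_linearMap (F := F) (V := V ⧸ N)]
  congr 1
  refine (Set.ncard_congr (fun f _ => f ∘ₗ N.mkQ) ?_ ?_ ?_).symm
  · intro f hf
    rw [Set.mem_ofPred_eq, LinearMap.ker_comp, hf, ← LinearMap.ker, Submodule.ker_mkQ]
  · intro f g _ _ h
    exact Submodule.linearMap_qext _ h
  · rintro e rfl
    exact ⟨(LinearMap.ker e).liftQ e le_rfl, Submodule.ker_liftQ_eq_bot _ _ _ le_rfl,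
      Submodule.liftQ_mkQ _ _ _⟩

/-- The number of `u`-dimensional subspaces. -/
theorem card_finrank_eq (u : ℕ) :
    ({K : Submodule F V | finrank F K = u}.ncard : ℝ) * A (Nat.card F) u u
      = A (Nat.card F) (finrank F V) u := by
  classical
  have : Finite V := Module.finite_of_finite F
  have := Fintype.ofFinite F
  have := Fintype.ofFinite V
  have : Finite (Submodule F V) := Finite.of_injective _ SetLike.coe_injective
  have := Fintype.ofFinite (Submodule F V)
  rw [← card_linearIndependent_eq_A (F := F) (V := V)]
  -- Sort the independent tuples by their span: the fibre over `K` consists of the ordered bases of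
  -- `K`.
  rw [Nat.card_congr (Equiv.sigmaFiberEquiv (fun s : {s : Fin u → V // LinearIndependent F s} =>
    (⟨Submodule.span F (Set.range s.1), by simpa using finrank_span_eq_card s.2⟩ :
      {K : Submodule F V // finrank F K = u}))).symm, Nat.card_sigma, Nat.cast_sum]
  rw [Finset.sum_congr rfl (g := fun _ => A (Nat.card F) u u), Finset.sum_const, nsmul_eq_mul]
  · rw [← Nat.card_coe_set_eq, Finset.card_univ, ← Nat.card_eq_fintype_card]
    rfl
  · rintro ⟨K, hK⟩ -
    have h := card_linearIndependent_eq_A (F := F) (V := K) u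
    rw [hK] at h
    rw [← h]
    congr 1
    symm
    refine Nat.card_congr (Equiv.ofBijective (fun s => ⟨⟨fun i => (s.1 i : V),
      s.2.map' K.subtype K.ker_subtype⟩, ?_⟩) ⟨?_, ?_⟩)
    · have h3 : LinearIndependent F (fun i => (s.1 i : V)) := s.2.map' K.subtype K.ker_subtype
      refine Subtype.ext (Submodule.eq_of_le_of_finrank_eq ?_ ?_)
      · rw [Submodule.span_le]
        rintro _ ⟨i, rfl⟩
        exact (s.1 i).2
      · rw [hK]
        simpa using finrank_span_eq_card h3
    · intro s s' h
      have h' := congrArg (fun x => x.1.1) h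
      exact Subtype.ext (funext fun i => Subtype.ext (congrFun h' i))
    · rintro ⟨⟨s, hs⟩, h⟩
      have h' : Submodule.span F (Set.range s) = K := congrArg Subtype.val h
      have hm : ∀ i, s i ∈ K := fun i => h' ▸ Submodule.subset_span ⟨i, rfl⟩
      exact ⟨⟨fun i => ⟨s i, hm i⟩, LinearIndependent.of_comp K.subtype hs⟩, rfl⟩

/-- A bound for the number of subspaces of codimension `u`. -/
theorem card_codim_eq_le (u : ℕ) :
    {K : Submodule F V | finrank F (V ⧸ K) = u}.ncard
      ≤ {K : Submodule F (Dual F V) | finrank F K = u}.ncard := by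
  have : Finite (Dual F V) := Module.finite_of_finite F
  have : Finite (Submodule F (Dual F V)) := Finite.of_injective _ SetLike.coe_injective
  refine Set.ncard_le_ncard_of_injOn Submodule.dualAnnihilator ?_ ?_ (Set.toFinite _)
  · rintro K rfl
    exact (Subspace.quotEquivAnnihilator K).finrank_eq.symm
  · intro K _ K' _ h
    exact Subspace.dualAnnihilator_inj.1 h

end Counting

/-! ### Estimates for the product `A(m,u)`. -/

theorem A_pos {q m u : ℕ} (hq : 1 < q) (h : u ≤ m) : 0 < A q m u :=
  Finset.prod_pos fun i hi => sub_pos.2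
    (pow_lt_pow_right₀ (by exact_mod_cast hq) ((Finset.mem_range.1 hi).trans_le h))

theorem A_le_pow {q m u : ℕ} (hq : 1 < q) (h : u ≤ m) : A q m u ≤ ((q : ℝ) ^ m - 1) ^ u := by
  have hq1 : (1 : ℝ) ≤ q := by exact_mod_cast hq.le
  rw [A, ← Finset.card_range u, ← Finset.prod_const, Finset.card_range]
  refine Finset.prod_le_prod (fun i hi => sub_nonneg.2 (pow_le_pow_right₀ hq1
    ((Finset.mem_range.1 hi).le.trans h))) fun i _ => ?_
  have := one_le_pow₀ hq1 (n := i)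
  linarith

/-- A Weierstrass-type product bound: with `Q = q ^ m`, the ratio of `A(m,u+1)` to `(Q - 1) ^ (u +
1)` is at least `1 - (q ^ (u + 1) - q) / Q`, a form that survives induction on `u`. -/
theorem le_pow_mul_A {q m u : ℕ} (hq : 1 < q) (h : u + 1 ≤ m) :
    ((q : ℝ) ^ m - (q : ℝ) ^ (u + 1) + q) * ((q : ℝ) ^ m - 1) ^ (u + 1)
      ≤ (q : ℝ) ^ m * A q m (u + 1) := by
  have hq2 : (2 : ℝ) ≤ q := by exact_mod_cast hq
  induction u with
  | zero => simp [A]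
  | succ u ih =>
    have ih := ih (by omega)
    rw [A, Finset.prod_range_succ, ← A]
    set Q := (q : ℝ) ^ m
    set a := (q : ℝ) ^ (u + 1) with ha
    have haQ : a ≤ Q := pow_le_pow_right₀ (by linarith) (by omega)
    have hqa : (q : ℝ) ≤ a := le_self_pow₀ (by linarith) (by omega)
    have hQ : 0 ≤ (Q - 1) ^ (u + 1) := pow_nonneg (by linarith) _
    -- Right side minus left side is exactly the sum of the products in `h1` and `h2`.
    have key : (Q - a * q + q) * (Q - 1) ≤ (Q - a + q) * (Q - a) := by
      have h1 : 0 ≤ (a - 1) * ((q - 1) * a - q) :=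
        mul_nonneg (by linarith) (by nlinarith)
      have h2 : 0 ≤ ((q - 2) * a + 1) * (Q - a) :=
        mul_nonneg (by nlinarith) (by linarith)
      nlinarith
    have e1 := mul_le_mul_of_nonneg_right ih (sub_nonneg.2 haQ)
    have e2 := mul_le_mul_of_nonneg_right key hQ
    rw [pow_succ (q : ℝ) (u + 1), ← ha, pow_succ (Q - 1) (u + 1)]
    nlinarith

/-- For `2 u ≤ m`, the product `A(m,u)` is at least `(1 - q⁻²) (q ^ m - 1) ^ u`. -/
theorem pow_le_A {q m u : ℕ} (hq : 1 < q) (h : 2 * u ≤ m) :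
    ((q : ℝ) ^ m - 1) ^ u ≤ (q : ℝ) ^ 2 / ((q : ℝ) ^ 2 - 1) * A q m u := by
  have hq2 : (2 : ℝ) ≤ q := by exact_mod_cast hq
  have hq3 : (0 : ℝ) < (q : ℝ) ^ 2 - 1 := by nlinarith
  rw [div_mul_eq_mul_div, le_div_iff₀ hq3]
  match u with
  | 0 => simp [A]
  | 1 =>
    have : (1 : ℝ) ≤ (q : ℝ) ^ m := one_le_pow₀ (by linarith)
    simp only [A, Finset.prod_range_one, pow_one, pow_zero]
    nlinarith
  | u + 2 =>
    have h1 := le_pow_mul_A (m := m) (u := u + 1) hq (by omega)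
    set Q := (q : ℝ) ^ m
    set X := (Q - 1) ^ (u + 1 + 1)
    have hQ : 0 < Q := by positivity
    have hQ1 : 1 ≤ Q := one_le_pow₀ (by linarith)
    have hX : 0 ≤ X := pow_nonneg (by linarith) _
    -- With `v = u + 2 ≥ 2`, `v + 2 ≤ 2 v ≤ m`; this is why 0 and 1 are treated separately.
    have h2 : (q : ℝ) ^ (u + 1 + 1) * (q : ℝ) ^ 2 ≤ Q := by
      rw [← pow_add]
      exact pow_le_pow_right₀ (by linarith) (by omega)
    refine le_of_mul_le_mul_left ?_ hQ
    have h3 := mul_le_mul_of_nonneg_left h1 (sq_nonneg (q : ℝ))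
    have h4 : Q * ((q : ℝ) ^ 2 - 1) ≤ (q : ℝ) ^ 2 * (Q - (q : ℝ) ^ (u + 1 + 1) + q) := by
      have : 0 ≤ (q : ℝ) ^ 2 * q := by positivity
      nlinarith
    have h5 := mul_le_mul_of_nonneg_right h4 hX
    calc Q * (X * ((q : ℝ) ^ 2 - 1)) = Q * ((q : ℝ) ^ 2 - 1) * X := by ring
      _ ≤ _ := h5
      _ = (q : ℝ) ^ 2 * ((Q - (q : ℝ) ^ (u + 1 + 1) + q) * X) := by ring
      _ ≤ _ := h3
      _ = _ := by ring

/-- Both sides are compared with powers of `q ^ m - 1`: `A_le_pow` on the left, `pow_le_A` on the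
right. -/
theorem A_sub_le {q m u s : ℕ} (hq : 1 < q) (h : 2 * u ≤ m) (hm : 0 < m) (hs : s ≤ u) :
    A q m (u - s) ≤ (q : ℝ) ^ 2 / ((q : ℝ) ^ 2 - 1) * (((q : ℝ) ^ m - 1) ^ s)⁻¹ * A q m u := by
  have hq1 : (1 : ℝ) < q := by exact_mod_cast hq
  have hQ : 0 < (q : ℝ) ^ m - 1 := sub_pos.2 (one_lt_pow₀ hq1 hm.ne')
  refine (A_le_pow hq (by omega)).trans ?_
  rw [mul_right_comm, ← div_eq_mul_inv, le_div_iff₀ (pow_pos hQ _), ← pow_add,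
    Nat.sub_add_cancel hs]
  exact pow_le_A hq h

/-! ### Decodable linear maps and their error patterns. -/

section Code

open Module LinearMap

variable {F V L : Type*} [Field F] [AddCommGroup V] [Module F V]

theorem exists_submodule_le_finrank_eq {T : Submodule F V} {s : ℕ} (h : s ≤ finrank F T) :
    ∃ S ≤ T, finrank F S = s := by
  obtain ⟨f, hf⟩ := exists_linearIndependent_of_le_finrank h
  have hf' : LinearIndependent F (fun i => (f i : V)) := hf.map' T.subtype T.ker_subtype
  refine ⟨Submodule.span F (Set.range fun i => (f i : V)), ?_, ?_⟩
  · rw [Submodule.span_le]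
    rintro _ ⟨i, rfl⟩
    exact (f i).2
  · simpa using finrank_span_eq_card hf'

variable [FiniteDimensional F V] [AddCommGroup L] [Module F L]

theorem finrank_range_add_finrank_le {f : V →ₗ[F] L} {P : Submodule F V} (h : P ≤ ker f) :
    finrank F (range f) + finrank F P ≤ finrank F V := by
  have h1 := finrank_range_add_finrank_ker f
  have h2 := Submodule.finrank_mono h
  omega

/-- By the modular law, a complement of `N ⊓ K` in `V` cuts `K` in a complement of `N ⊓ K` within
`K`, which has room for `S`. -/
theorem exists_disjoint_submodule {N K : Submodule F V} {s : ℕ}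
    (h : s + finrank F (N ⊓ K : Submodule F V) ≤ finrank F K) :
    ∃ S ≤ K, Disjoint N S ∧ finrank F S = s := by
  obtain ⟨T, hT⟩ := Submodule.exists_isCompl (N ⊓ K)
  have h1 : (N ⊓ K) ⊔ (T ⊓ K) = K := by
    rw [← sup_inf_assoc_of_le T (inf_le_right : N ⊓ K ≤ K), hT.sup_eq_top, top_inf_eq]
  have h2 := Submodule.finrank_add_le_finrank_add_finrank (N ⊓ K) (T ⊓ K)
  rw [h1] at h2
  obtain ⟨S, hS, hs⟩ := exists_submodule_le_finrank_eq (T := T ⊓ K) (s := s) (by omega)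
  refine ⟨S, hS.trans inf_le_right, ?_, hs⟩
  refine Disjoint.mono_right hS ?_
  rw [disjoint_iff, eq_bot_iff, ← hT.inf_eq_bot]
  exact le_inf (le_inf inf_le_left (inf_le_right.trans inf_le_right))
    (inf_le_right.trans inf_le_left)

variable {C : Set (V →ₗ[F] L)} {s u : ℕ} {K N : Submodule F V}

/-- The error patterns that move a nonzero codeword of `C` to a map vanishing on `K`. -/
def errorSet (C : Set (V →ₗ[F] L)) (K : Submodule F V) : Set (V →ₗ[F] L) :=
  {e | ∃ c ∈ C, c ≠ 0 ∧ ∀ v ∈ K, e v = -c v}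

/-- The codeword attached to `e` vanishes on `ker e ⊓ K`, yet its rank exceeds `s + u`. -/
theorem add_finrank_ker_inf_lt
    (hC : ∀ c ∈ C, ∀ c' ∈ C, c ≠ c' → s + u < finrank F (range (c - c'))) (h0 : 0 ∈ C)
    (hK : finrank F K + u = finrank F V) {e : V →ₗ[F] L} (he : e ∈ errorSet C K) :
    s + finrank F (ker e ⊓ K : Submodule F V) < finrank F K := by
  obtain ⟨c, hc, hc0, hec⟩ := he
  have h1 := hC c hc 0 h0 hc0
  rw [sub_zero] at h1
  have h2 : ker e ⊓ K ≤ ker c := fun v hv => by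
    have := hec v hv.2
    rw [hv.1, zero_eq_neg] at this
    exact this
  have := finrank_range_add_finrank_le h2
  omega

/-- Two error patterns of `C` that agree on a subspace `W` of codimension `s` agree on `K`. -/
theorem eqOn_of_eqOn
    (hC : ∀ c ∈ C, ∀ c' ∈ C, c ≠ c' → s + u < finrank F (range (c - c')))
    (hK : finrank F K + u = finrank F V) {W : Submodule F V}
    (hW : finrank F W + s = finrank F V) {e e' : V →ₗ[F] L} (he : e ∈ errorSet C K)
    (he' : e' ∈ errorSet C K) (h : ∀ v ∈ W, e v = e' v) : ∀ v ∈ K, e v = e' v := by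
  obtain ⟨c, hc, -, hec⟩ := he
  obtain ⟨c', hc', -, hec'⟩ := he'
  have hcc : c = c' := by
    by_contra hne
    have h1 := hC c hc c' hc' hne
    -- `K ⊓ W` has codimension at most `u + s`, so `c - c'` would have too small a rank.
    have h2 : K ⊓ W ≤ ker (c - c') := fun v hv => by
      have h3 := h v hv.2
      rw [hec v hv.1, hec' v hv.1, neg_inj] at h3
      rw [mem_ker, LinearMap.sub_apply, h3, sub_self]
    have h3 := finrank_range_add_finrank_le h2
    have h4 := Submodule.finrank_sup_add_finrank_inf_eq K W
    have h5 := Submodule.finrank_le (K ⊔ W)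
    omega
  intro v hv
  rw [hec v hv, hec' v hv, hcc]

variable [Finite F] [FiniteDimensional F L]

/-- The number of error patterns of a code with a given kernel `N`. -/
theorem ncard_errorSet_ker_le
    (hC : ∀ c ∈ C, ∀ c' ∈ C, c ≠ c' → s + u < finrank F (range (c - c'))) (h0 : 0 ∈ C)
    (hK : finrank F K + u = finrank F V) (hN : ∃ e ∈ errorSet C K, ker e = N) :
    s ≤ finrank F (V ⧸ N) ∧
    ({e | e ∈ errorSet C K ∧ ker e = N}.ncard : ℝ)
      ≤ A (Nat.card F) (finrank F L) (finrank F (V ⧸ N) - s) := by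
  have : Finite (V →ₗ[F] L) := Module.finite_of_finite F
  have hlt : s + finrank F (N ⊓ K : Submodule F V) < finrank F K := by
    obtain ⟨e, he, rfl⟩ := hN
    exact add_finrank_ker_inf_lt hC h0 hK he
  obtain ⟨S, hSK, hNS, hS⟩ := exists_disjoint_submodule hlt.le
  obtain ⟨W, hNW, hWS⟩ := hNS.exists_isCompl
  have hW := Submodule.finrank_add_eq_of_isCompl hWS
  rw [hS] at hW
  have hfN := N.finrank_quotient_add_finrank
  have hNW' := Submodule.finrank_mono hNW
  refine ⟨by omega, ?_⟩
  have hcodim : finrank F (W ⧸ N.comap W.subtype) = finrank F (V ⧸ N) - s := by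
    have h1 := (N.comap W.subtype).finrank_quotient_add_finrank
    rw [(Submodule.comapSubtypeEquivOfLe hNW).finrank_eq] at h1
    omega
  rw [← hcodim, ← card_ker_eq]
  have : Finite (W →ₗ[F] L) := Module.finite_of_finite F
  refine Nat.cast_le.2 (Set.ncard_le_ncard_of_injOn (fun e => e ∘ₗ W.subtype) ?_ ?_
    (Set.toFinite _))
  · rintro e ⟨-, rfl⟩
    exact ker_comp _ _
  · rintro e ⟨he, -⟩ e' ⟨he', -⟩ h
    have hW1 : ∀ v ∈ W, e v = e' v := fun v hv => LinearMap.congr_fun h ⟨v, hv⟩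
    have hK1 := eqOn_of_eqOn hC hK hW he he' hW1
    have : (⊤ : Submodule F V) ≤ eqLocus e e' := by
      rw [← hWS.sup_eq_top]
      exact sup_le hW1 fun v hv => hK1 v (hSK hv)
    exact LinearMap.ext fun v => this (Submodule.mem_top : v ∈ ⊤)

theorem ncard_eq_sum_fiber {α ι : Type*} [Finite α] [Fintype ι] (f : α → ι) (S : Set α) :
    S.ncard = ∑ i, {x | x ∈ S ∧ f x = i}.ncard := by
  classical
  have := Fintype.ofFinite α
  rw [Set.ncard_eq_toFinset_card', Finset.card_eq_sum_card_fiberwise (f := f) (t := Finset.univ)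
    (fun _ _ => Finset.mem_coe.2 (Finset.mem_univ _))]
  refine Finset.sum_congr rfl fun i _ => ?_
  rw [Set.ncard_eq_toFinset_card']
  congr 1
  ext x
  simp

/-- The error patterns of rank at most `t` of a code, compared with all nonzero linear maps of
rank at most `t`. -/
theorem ncard_errorSet_le {t : ℕ}
    (hC : ∀ c ∈ C, ∀ c' ∈ C, c ≠ c' → s + u < finrank F (range (c - c'))) (h0 : 0 ∈ C)
    (hK : finrank F K + u = finrank F V) (ht : 2 * t ≤ finrank F L) (hL : 0 < finrank F L) :
    ({e | e ∈ errorSet C K ∧ finrank F (range e) ≤ t}.ncard : ℝ)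
      ≤ (Nat.card F : ℝ) ^ 2 / ((Nat.card F : ℝ) ^ 2 - 1) *
        (((Nat.card F : ℝ) ^ finrank F L - 1) ^ s)⁻¹ *
        ({e : V →ₗ[F] L | finrank F (range e) ≤ t ∧ e ≠ 0}.ncard : ℝ) := by
  classical
  have : Finite V := Module.finite_of_finite F
  have : Finite (V →ₗ[F] L) := Module.finite_of_finite F
  have : Finite (Submodule F V) := Finite.of_injective _ SetLike.coe_injective
  have := Fintype.ofFinite (Submodule F V)
  have hq : 1 < Nat.card F := Finite.one_lt_card
  have hq1 : (1 : ℝ) < Nat.card F := by exact_mod_cast hq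
  set q := Nat.card F
  set m := finrank F L
  rw [ncard_eq_sum_fiber (fun e : V →ₗ[F] L => ker e),
    ncard_eq_sum_fiber (fun e : V →ₗ[F] L => ker e)
      {e : V →ₗ[F] L | finrank F (range e) ≤ t ∧ e ≠ 0}]
  push_cast
  rw [Finset.mul_sum]
  refine Finset.sum_le_sum fun N _ => ?_
  have hβ : 0 ≤ (q : ℝ) ^ 2 / ((q : ℝ) ^ 2 - 1) * (((q : ℝ) ^ m - 1) ^ s)⁻¹ :=
    mul_nonneg (div_nonneg (by positivity) (sub_nonneg.2 (one_le_pow₀ hq1.le)))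
      (inv_nonneg.2 (pow_nonneg (sub_nonneg.2 (one_le_pow₀ hq1.le)) _))
  have hrank : ∀ e : V →ₗ[F] L, finrank F (range e) = finrank F (V ⧸ ker e) :=
    fun e => e.quotKerEquivRange.finrank_eq.symm
  by_cases hN : ∃ e, (e ∈ errorSet C K ∧ finrank F (range e) ≤ t) ∧ ker e = N
  · obtain ⟨e, ⟨he, het⟩, rfl⟩ := hN
    obtain ⟨hs, hle⟩ := ncard_errorSet_ker_le hC h0 hK ⟨e, he, rfl⟩
    have hlt := add_finrank_ker_inf_lt hC h0 hK he
    have he0 : ker e ≠ ⊤ := fun h => by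
      rw [h, top_inf_eq] at hlt
      omega
    -- Rank depends only on the kernel, so every map with this proper kernel lies in the punctured
    -- ball.
    have h1 : {e' : V →ₗ[F] L | e' ∈ {e' : V →ₗ[F] L | finrank F (range e') ≤ t ∧ e' ≠ 0} ∧
        ker e' = ker e} = {e' | ker e' = ker e} := by
      ext e'
      refine ⟨fun h => h.2, fun h => ⟨⟨?_, ?_⟩, h⟩⟩
      · rw [hrank, show ker e' = ker e from h, ← hrank]
        exact het
      · rintro rfl
        exact he0 (h.symm.trans ker_zero)
    rw [h1, card_ker_eq]
    refine le_trans (Nat.cast_le.2 (Set.ncard_le_ncard ?_ (Set.toFinite _))) (hle.trans ?_)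
    · exact fun e' h => ⟨h.1.1, h.2⟩
    · refine A_sub_le hq ?_ hL hs
      rw [← hrank]
      omega
  · have : {e | e ∈ {e | e ∈ errorSet C K ∧ finrank F (range e) ≤ t} ∧ ker e = N} = ∅ :=
      Set.eq_empty_iff_forall_notMem.2 fun e he => hN ⟨e, he⟩
    rw [this, Set.ncard_empty, Nat.cast_zero]
    positivity

/-- Decodable maps with kernel `K` correspond to error patterns. -/
theorem ncard_decodable_ker_le {t : ℕ}
    (hC : ∀ c ∈ C, ∀ c' ∈ C, c ≠ c' → s + u < finrank F (range (c - c')))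
    (hK : finrank F K + u = finrank F V) (htu : t < u) :
    {x : V →ₗ[F] L | ker x = K ∧ ∃ c ∈ C, finrank F (range (x - c)) ≤ t}.ncard
      ≤ {e | e ∈ errorSet C K ∧ finrank F (range e) ≤ t}.ncard := by
  have : Finite (V →ₗ[F] L) := Module.finite_of_finite F
  choose! c hcC hct using fun (x : V →ₗ[F] L) (h : ∃ c ∈ C, finrank F (range (x - c)) ≤ t) => h
  refine Set.ncard_le_ncard_of_injOn (fun x => x - c x) ?_ ?_ (Set.toFinite _)
  · rintro x ⟨hx, hxt⟩
    -- If `c x = 0`, then `x` itself has rank at most `t < u`.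
    refine ⟨⟨c x, hcC x hxt, fun h => ?_, fun v hv => ?_⟩, hct x hxt⟩
    · have h1 := hct x hxt
      have h2 := finrank_range_add_finrank_ker x
      rw [h, sub_zero] at h1
      rw [hx] at h2
      omega
    · rw [← hx, mem_ker] at hv
      rw [LinearMap.sub_apply, hv, zero_sub]
  · rintro x ⟨hx, hxt⟩ y ⟨hy, hyt⟩ h
    have h' : x - y = c x - c y := by
      have : x - c x = y - c y := h
      rw [sub_eq_sub_iff_add_eq_add] at this ⊢
      rw [this, add_comm]
    have hcc : c x = c y := by
      by_contra hne
      have h1 := hC _ (hcC x hxt) _ (hcC y hyt) hne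
      have h2 : K ≤ ker (x - y) := fun v hv => by
        have hxv : v ∈ ker x := hx ▸ hv
        have hyv : v ∈ ker y := hy ▸ hv
        rw [mem_ker] at hxv hyv ⊢
        rw [LinearMap.sub_apply, hxv, hyv, sub_zero]
      have h3 := finrank_range_add_finrank_le h2
      rw [h'] at h3
      omega
    rwa [hcc, sub_self, sub_eq_zero] at h'

/-- The bound on the number of decodable linear maps of rank `u`. -/
theorem ncard_decodable_lt {t : ℕ}
    (hC : ∀ c ∈ C, ∀ c' ∈ C, c ≠ c' → s + u < finrank F (range (c - c'))) (h0 : 0 ∈ C)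
    (huV : u ≤ finrank F V) (htu : t < u) (ht : 2 * t ≤ finrank F L) (hL : 0 < finrank F L) :
    ({x : V →ₗ[F] L | finrank F (range x) = u ∧
        ∃ c ∈ C, finrank F (range (x - c)) ≤ t}.ncard : ℝ)
      < (Nat.card F : ℝ) ^ 2 / ((Nat.card F : ℝ) ^ 2 - 1) *
        gaussianBinomial (Nat.card F) (finrank F V) u *
        (((Nat.card F : ℝ) ^ finrank F L - 1) ^ s)⁻¹ *
        ({e : V →ₗ[F] L | finrank F (range e) ≤ t}.ncard : ℝ) := by
  classical
  have : Finite V := Module.finite_of_finite F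
  have : Finite (V →ₗ[F] L) := Module.finite_of_finite F
  have : Finite (Submodule F V) := Finite.of_injective _ SetLike.coe_injective
  have := Fintype.ofFinite (Submodule F V)
  have hq : 1 < Nat.card F := Finite.one_lt_card
  have hq1 : (1 : ℝ) < Nat.card F := by exact_mod_cast hq
  have hball : ({e : V →ₗ[F] L | finrank F (range e) ≤ t ∧ e ≠ 0}.ncard : ℝ)
      < ({e : V →ₗ[F] L | finrank F (range e) ≤ t}.ncard : ℝ) := by
    refine Nat.cast_lt.2 (Set.ncard_lt_ncard ⟨fun e he => he.1, fun h => ?_⟩ (Set.toFinite _))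
    exact (h (show (0 : V →ₗ[F] L) ∈ {e : V →ₗ[F] L | finrank F (range e) ≤ t} by
      rw [Set.mem_ofPred_eq, range_zero, finrank_bot]
      exact Nat.zero_le t)).2 rfl
  have hg : ({K : Submodule F V | finrank F (V ⧸ K) = u}.ncard : ℝ)
      ≤ gaussianBinomial (Nat.card F) (finrank F V) u := by
    rw [gaussianBinomial, le_div_iff₀ (A_pos hq le_rfl), ← Subspace.dual_finrank_eq (V := V),
      ← card_finrank_eq]
    exact mul_le_mul_of_nonneg_right (Nat.cast_le.2 (card_codim_eq_le u)) (A_pos hq le_rfl).le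
  have hgpos : 0 < gaussianBinomial (Nat.card F) (finrank F V) u :=
    div_pos (A_pos hq huV) (A_pos hq le_rfl)
  have hβ : 0 < (Nat.card F : ℝ) ^ 2 / ((Nat.card F : ℝ) ^ 2 - 1) *
      (((Nat.card F : ℝ) ^ finrank F L - 1) ^ s)⁻¹ :=
    mul_pos (div_pos (by positivity) (sub_pos.2 (one_lt_pow₀ hq1 two_ne_zero)))
      (inv_pos.2 (pow_pos (sub_pos.2 (one_lt_pow₀ hq1 hL.ne')) _))
  set q := Nat.card F
  set m := finrank F L
  set M : ℝ := (q : ℝ) ^ 2 / ((q : ℝ) ^ 2 - 1) * (((q : ℝ) ^ m - 1) ^ s)⁻¹ *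
    ({e : V →ₗ[F] L | finrank F (range e) ≤ t ∧ e ≠ 0}.ncard : ℝ) with hM
  have hM0 : 0 ≤ M := mul_nonneg hβ.le (Nat.cast_nonneg _)
  refine lt_of_le_of_lt (b := gaussianBinomial q (finrank F V) u * M) ?_ ?_
  · refine le_trans ?_ (mul_le_mul_of_nonneg_right hg hM0)
    rw [ncard_eq_sum_fiber (fun e : V →ₗ[F] L => ker e), Set.ncard_eq_toFinset_card',
      ← nsmul_eq_mul, ← Finset.sum_const]
    push_cast
    -- Only kernels of codimension `u` contribute; each contributes at most `M`.
    refine le_trans (le_of_eq (Finset.sum_subset (Finset.subset_univ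
      {K : Submodule F V | finrank F (V ⧸ K) = u}.toFinset) fun K _ hK => ?_).symm)
      (Finset.sum_le_sum fun K hK => ?_)
    · rw [Nat.cast_eq_zero, Set.ncard_eq_zero (Set.toFinite _), Set.eq_empty_iff_forall_notMem]
      rintro x ⟨⟨hx, -⟩, rfl⟩
      exact hK (Set.mem_toFinset.2 (x.quotKerEquivRange.finrank_eq.trans hx))
    · replace hK : K ∈ {K : Submodule F V | finrank F (V ⧸ K) = u} := Set.mem_toFinset.1 hK
      rw [Set.mem_ofPred_eq] at hK
      have hK' : finrank F K + u = finrank F V := by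
        rw [← hK, add_comm, K.finrank_quotient_add_finrank]
      refine le_trans (Nat.cast_le.2 ((Set.ncard_le_ncard ?_ (Set.toFinite _)).trans
        (ncard_decodable_ker_le (t := t) hC hK' htu))) (ncard_errorSet_le hC h0 hK' ht hL)
      exact fun x hx => ⟨hx.2, hx.1.2⟩
  · have := mul_lt_mul_of_pos_left hball (mul_pos hgpos hβ)
    calc _ = _ := by rw [hM, ← mul_assoc]
      _ < _ := this
      _ = _ := by ring

end Code

/-! ### From vectors to linear maps, and the distance of an MRD code. -/

section Coordinates

open Module

variable {F L : Type*} [Field F] [Field L] [Algebra F L] {n : ℕ}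

/-- The linear map `F ^ n → L` sending the standard basis to the coordinates of a vector. -/
noncomputable def toLinearMap (F L : Type*) [Field F] [Field L] [Algebra F L] (n : ℕ) :
    (Fin n → L) ≃ₗ[F] ((Fin n → F) →ₗ[F] L) :=
  (Pi.basisFun F (Fin n)).constr F

theorem rk_eq_finrank_range [FiniteDimensional F L] (x : Fin n → L) :
    rk F x = finrank F (LinearMap.range (toLinearMap F L n x)) := by
  rw [rk_eq_finrank_span, toLinearMap, Basis.constr_range]

theorem rankDist_eq_finrank_range [FiniteDimensional F L] (x y : Fin n → L) :
    rankDist F x y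
      = finrank F (LinearMap.range (toLinearMap F L n x - toLinearMap F L n y)) := by
  rw [rankDist, rk_eq_finrank_range, map_sub]

theorem ballVolume_eq [FiniteDimensional F L] [Finite L] (t : ℕ) :
    ballVolume F L n t = {x : Fin n → L | rk F x ≤ t}.ncard := by
  classical
  have := Fintype.ofFinite L
  simp only [ballVolume, numRank, Set.ncard_eq_toFinset_card']
  rw [Finset.card_eq_sum_card_fiberwise (f := rk F) (t := Finset.range (t + 1))
    (fun x hx => by simpa [Nat.lt_succ_iff] using hx)]
  refine Finset.sum_congr rfl fun i hi => ?_
  congr 1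
  ext x
  have := Finset.mem_range.1 hi
  simp only [Set.mem_toFinset, Finset.mem_filter, Set.mem_ofPred_eq]
  omega

theorem minRankDist_le [FiniteDimensional F L] {C : Set (Fin n → L)} {x y : Fin n → L}
    (hx : x ∈ C) (hy : y ∈ C) (h : x ≠ y) : minRankDist F C ≤ rankDist F x y :=
  Nat.sInf_le ⟨x, hx, y, hy, h, rfl⟩

theorem IsMRD.minRankDist_eq [Finite F] [FiniteDimensional F L] {C : Set (Fin n → L)} {k r : ℕ}
    (hC : IsMRD F C) (hk : C.ncard = Nat.card F ^ (finrank F L * k)) (hr : r + k = n) :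
    minRankDist F C = r + 1 := by
  have h := hC.2
  have hq : 1 < Nat.card F := Finite.one_lt_card
  have hq1 : (1 : ℝ) < Nat.card F := by exact_mod_cast hq
  have hQ : (1 : ℝ) < (Nat.card F : ℝ) ^ finrank F L := one_lt_pow₀ hq1 finrank_pos.ne'
  rw [hk, Nat.cast_pow, pow_mul, Real.logb_pow, Real.logb_self_eq_one hQ, mul_one] at h
  have hn : (n : ℝ) = r + k := by rw [← hr, Nat.cast_add]
  have : (minRankDist F C : ℝ) = ((r + 1 : ℕ) : ℝ) := by
    rw [h, hn]
    push_cast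
    ring
  exact_mod_cast this

end Coordinates

end RankMetric

theorem mainTheorem4 {F L : Type*} [Field F] [Finite F] [Field L] [Finite L] [Algebra F L]
    (q m n k r d t u : ℕ)
    (hq : Nat.card F = q) (hm : Module.finrank F L = m) (hnm : n ≤ m)
    (C : Set (Fin n → L)) (hC : RankMetric.IsMRD F C) (hzero : (0 : Fin n → L) ∈ C)
    (hk : C.ncard = q ^ (m * k)) (hr : r + k = n)
    (hd : d = RankMetric.minRankDist F C) (ht : t = (d - 1) / 2)
    (hu₁ : d - t ≤ u) (hu₂ : u < d) :
    (RankMetric.numDecodable F C t u : ℝ) <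
      (q : ℝ) ^ 2 / ((q : ℝ) ^ 2 - 1) * RankMetric.gaussianBinomial q n u *
        ((q : ℝ) ^ m - 1) ^ ((u : ℤ) - (r : ℤ)) * (RankMetric.ballVolume F L n t : ℝ) := by
  subst hq hm
  have hd' : d = r + 1 := hd.trans (hC.minRankDist_eq hk hr)
  -- Since `u ≤ r`, the exponent `u - r` is `-s`, and `s + u < d` is the distance condition used
  -- above.
  obtain ⟨s, rfl⟩ : ∃ s, r = s + u := ⟨r - u, by omega⟩
  let T := RankMetric.toLinearMap F L n
  have key := RankMetric.ncard_decodable_lt (F := F) (V := Fin n → F) (L := L) (C := T '' C)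
    (s := s) (u := u) (t := t) ?_ ⟨0, hzero, map_zero T⟩ (by simp; omega) (by omega) (by omega)
    Module.finrank_pos
  · have h1 : RankMetric.numDecodable F C t u = {x : (Fin n → F) →ₗ[F] L |
        Module.finrank F (LinearMap.range x) = u ∧
        ∃ c ∈ T '' C, Module.finrank F (LinearMap.range (x - c)) ≤ t}.ncard := by
      rw [RankMetric.numDecodable, ← Set.ncard_image_of_injective _ T.injective]
      congr 1
      ext x
      obtain ⟨x, rfl⟩ := T.surjective x
      rw [T.injective.mem_set_image]
      simp only [Set.mem_ofPred_eq, Set.exists_mem_image, RankMetric.Decodable,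
        RankMetric.rankDist_eq_finrank_range, RankMetric.rk_eq_finrank_range, T]
    have h2 : RankMetric.ballVolume F L n t = {e : (Fin n → F) →ₗ[F] L |
        Module.finrank F (LinearMap.range e) ≤ t}.ncard := by
      rw [RankMetric.ballVolume_eq, ← Set.ncard_image_of_injective _ T.injective]
      congr 1
      ext x
      obtain ⟨x, rfl⟩ := T.surjective x
      simp [T, RankMetric.rk_eq_finrank_range]
    have h3 : (u : ℤ) - ((s + u : ℕ) : ℤ) = -(s : ℤ) := by
      push_cast
      ring
    rw [h1, h2, h3, zpow_neg, zpow_natCast]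
    simpa using key
  · rintro _ ⟨c, hc, rfl⟩ _ ⟨c', hc', rfl⟩ hne
    rw [← RankMetric.rankDist_eq_finrank_range]
    have := RankMetric.minRankDist_le (F := F) hc hc' fun h => hne (congrArg T h)
    rw [← hd] at this
    exact lt_of_lt_of_le (by omega) this
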